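/- Let $d \le D$, let $\mathcal X, \mathcal Z \subset \mathbb R^D$ be finite, and put $\Theta_d = \{\theta \in \mathbb R^D : \theta_i = 0 \text{ for all } i > d\}$. For $x \in \mathbb R^D$ let $\psi_d(x) \in \mathbb R^d$ be the vector of the first $d$ coordinates of $x$. **Algorithms.** Let $\theta \in \Theta_d$ be an unknown reward vector. In round $t = 1, 2, \dots$ an algorithm plays an action $X_t \in \mathcal X$ that is measurable with respect to $\mathcal F_{t-1} = \sigma((X_i, Y_i)_{i < t})$, and observes $Y_t = \langle \theta, X_t\rangle + \xi_t$, where $\xi_1, \xi_2, \dots$ are i.i.d. $\mathcal N(0,1)$. It has a (possibly infinite) stopping time $\tau$ with respect to $(\mathcal F_t)_{t \ge 0}$ and an $\mathcal F_\tau$-measurable recommendation $\widehat z \in \mathcal Z$. Write $\mathbb P_\theta$, $\mathbb E_\theta$ for the resulting law and expectation. The algorithm is *$\delta$-PAC for $(\mathcal X, \mathcal Z, \Theta_d)$* if $$\mathbb P_\theta\Big(\tau < \infty \text{ and } \widehat z \in \operatorname*{argmax}_{z \in \mathcal Z} \langle \theta, z\rangle\Big) \ge 1 - \delta$$ for every $\theta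 \in \Theta_d$ whose optimal arm in $\mathcal Z$ is unique; here targets $z, z'$ with $\psi_d(z) = \psi_d(z')$, which have the same reward for every parameter in $\Theta_d$, count as the same arm. **Complexity.** Let $\theta_\star \in \Theta_d$ be such that $z_\star = \operatorname{argmax}_{z \in \mathcal Z} \langle \theta_\star, z \rangle$ is unique (as an element of $\mathcal Z$). For $\lambda$ in the probability simplex $\Lambda_{\mathcal X}$ over $\mathcal X$ put $A_d(\lambda) = \sum_{x \in \mathcal X} \lambda_x \psi_d(x)\psi_d(x)^\top$, and let $$\rho^\star_d = \inf_{\lambda \in \Lambda_{\mathcal X}} \ \sup_{z \in \mathcal Z \setminus \{z_\star\}} \frac{\|\psi_d(z_\star) - \psi_d(z)\|^2_{A_d(\lambda)^{-1}}}{\langle \theta_\star, z_\star - z\rangle^2} \in [0, \infty],$$ where $\|y\|^2_{A^{-1}} = y^\top A^{+} y$, with $A^+$ the pseudo-inverse, if $y$ lies in the range of $A$, and $\|y\|^2_{A^{-1}} = \infty$ otherwise (and the supremum over the empty set is $0$). **Theorem.** Let $\delta \in (0, 0.15]$. Every algorithm that is $\delta$-PAC for $(\mathcal X, \mathcal Z,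 \Theta_d)$ satisfies $$\mathbb E_{\theta_\star}[\tau] \ \ge\ \rho^\star_d \, \log\!\Big(\frac{1}{2.4\,\delta}\Big).$$ In particular this holds for $d = d_\star$, the smallest $d$ with $\theta_\star \in \Theta_d$. -/

import Mathlib

open MeasureTheory ProbabilityTheory
open scoped ENNReal Matrix

namespace LinearBandit

/-- The ambient feature space `ℝ^D`. -/
abbrev Vec (D : ℕ) : Type := EuclideanSpace ℝ (Fin D)

/-- The parameter class `Θ_d` of the vectors of `ℝ^D` whose coordinates after the first `d` vanish. -/
def paramClass (D d : ℕ) : Set (Vec D) := {θ | ∀ i : Fin D, d ≤ (i : ℕ) → θ i = 0}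

/-- The truncated feature vector `ψ_d(x)`, i.e. the first `d` coordinates of `x`. -/
def truncate {D d : ℕ} (hd : d ≤ D) (x : Vec D) : Fin d → ℝ := fun i => x (Fin.castLE hd i)

section Complexity

/-- The design matrix `A_d(l) = ∑_{x ∈ X} l_x ψ_d(x) ψ_d(x)ᵀ`. -/
noncomputable def designMatrix {D d : ℕ} (hd : d ≤ D) (X : Finset (Vec D)) (l : X → ℝ) :
    Matrix (Fin d) (Fin d) ℝ :=
  ∑ x : X, l x • Matrix.vecMulVec (truncate hd (x : Vec D)) (truncate hd (x : Vec D))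

open Classical in
/-- `‖y‖²_{A⁻¹}` for a symmetric, possibly singular matrix `A`: it is `yᵀ A⁺ y = yᵀ v`, for any `v`
with `A v = y`, if `y` is in the range of `A`, and `∞` otherwise. The lemmas below show that
the choice of `v` is immaterial, that every generalized inverse (in particular the pseudo-inverse)
gives the same value, and that this is `yᵀ A⁻¹ y` if `A` is invertible. -/
noncomputable def invNormSq {d : ℕ} (A : Matrix (Fin d) (Fin d) ℝ) (y : Fin d → ℝ) : ℝ≥0∞ :=
  if h : ∃ v : Fin d → ℝ, A *ᵥ v = y then ENNReal.ofReal (y ⬝ᵥ h.choose) else ∞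

theorem invNormSq_eq {d : ℕ} {A : Matrix (Fin d) (Fin d) ℝ} (hA : Aᵀ = A) {y v : Fin d → ℝ}
    (hv : A *ᵥ v = y) : invNormSq A y = ENNReal.ofReal (y ⬝ᵥ v) := by
  have h : ∃ v : Fin d → ℝ, A *ᵥ v = y := ⟨v, hv⟩
  have hw : A *ᵥ h.choose = y := h.choose_spec
  have key : y ⬝ᵥ h.choose = y ⬝ᵥ v := by
    calc y ⬝ᵥ h.choose = (A *ᵥ v) ⬝ᵥ h.choose := by rw [hv]
      _ = v ⬝ᵥ (A *ᵥ h.choose) := by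
          rw [Matrix.dotProduct_mulVec, ← Matrix.mulVec_transpose, hA]
      _ = y ⬝ᵥ v := by rw [hw, dotProduct_comm]
  unfold invNormSq
  rw [dif_pos h, key]

theorem invNormSq_eq_top {d : ℕ} {A : Matrix (Fin d) (Fin d) ℝ} {y : Fin d → ℝ}
    (h : ¬ ∃ v : Fin d → ℝ, A *ᵥ v = y) : invNormSq A y = ∞ := by
  unfold invNormSq
  rw [dif_neg h]

theorem invNormSq_eq_generalizedInverse {d : ℕ} {A G : Matrix (Fin d) (Fin d) ℝ} (hA : Aᵀ = A)
    (hG : A * G * A = A) {y : Fin d → ℝ} (h : ∃ v : Fin d → ℝ, A *ᵥ v = y) :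
    invNormSq A y = ENNReal.ofReal (y ⬝ᵥ (G *ᵥ y)) := by
  obtain ⟨v, rfl⟩ := h
  refine invNormSq_eq hA ?_
  rw [Matrix.mulVec_mulVec, Matrix.mulVec_mulVec, hG]

theorem invNormSq_eq_inv {d : ℕ} {A : Matrix (Fin d) (Fin d) ℝ} (hA : Aᵀ = A)
    (hdet : IsUnit A.det) (y : Fin d → ℝ) :
    invNormSq A y = ENNReal.ofReal (y ⬝ᵥ (A⁻¹ *ᵥ y)) := by
  refine invNormSq_eq hA ?_
  rw [Matrix.mulVec_mulVec, Matrix.mul_nonsing_inv A hdet, Matrix.one_mulVec]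

/-- The design matrix is symmetric, so that the lemmas above apply to it. -/
theorem designMatrix_transpose {D d : ℕ} (hd : d ≤ D) (X : Finset (Vec D)) (l : X → ℝ) :
    (designMatrix hd X l)ᵀ = designMatrix hd X l := by
  simp [designMatrix, Matrix.transpose_sum, Matrix.transpose_vecMulVec]

/-- The complexity `ρ*_d` of `(X, Z, θ)` with optimal arm `zs`: the infimum over the designs `l` in
the simplex over `X` of the supremum over `z ∈ Z \ {zs}` of
`‖ψ_d(zs) - ψ_d(z)‖²_{A_d(l)⁻¹} / (h(zs) - h(z))²`, where `h(x) = ⟨θ, x⟩`. -/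
noncomputable def complexity {D d : ℕ} (hd : d ≤ D) (X Z : Finset (Vec D)) (θ zs : Vec D) : ℝ≥0∞ :=
  ⨅ l ∈ stdSimplex ℝ X, ⨆ z ∈ {z : Vec D | z ∈ Z ∧ z ≠ zs},
    invNormSq (designMatrix hd X l) (truncate hd zs - truncate hd z) /
      ENNReal.ofReal ((inner ℝ θ zs - inner ℝ θ z) ^ 2)

end Complexity

section Algorithms

/-- The filtration of the observations on the space of the trajectories `(x_i, y_i)_{i ∈ ℕ}`: the
`σ`-algebra with index `t` is generated by the first `t` pairs `(x_i, y_i)`, `i < t`. -/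
def history {D : ℕ} (X : Finset (Vec D)) :
    Filtration ℕ (inferInstance : MeasurableSpace (ℕ → X × ℝ)) where
  seq t := MeasurableSpace.comap (fun (ω : ℕ → X × ℝ) (i : Fin t) => ω i) inferInstance
  mono' s t hst := by
    rintro _ ⟨B, hB, rfl⟩
    refine ⟨(fun (f : Fin t → X × ℝ) (i : Fin s) => f (Fin.castLE hst i)) ⁻¹' B, ?_, rfl⟩
    exact (measurable_pi_lambda _ fun i => measurable_pi_apply (Fin.castLE hst i)) hB
  le' t := (measurable_pi_lambda _ fun i : Fin t =>
    measurable_pi_apply (X := fun _ : ℕ => X × ℝ) (i : ℕ)).comap_le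

/-- A pure exploration algorithm with action set `X` and target set `Z`. In round `t` (rounds are
numbered from `0`) it plays the action `arm t`, a measurable function of the observations
`(x_i, y_i)`, `i < t`. It stops after `τ` observations, where `τ` is a (possibly infinite)
stopping time, and then recommends the target `recommend`, which is determined by the
observations up to time `τ`. -/
structure Algorithm {D : ℕ} (X Z : Finset (Vec D)) where
  arm : (t : ℕ) → (Fin t → X × ℝ) → X
  measurable_arm : ∀ t, Measurable (arm t)
  τ : (ℕ → X × ℝ) → WithTop ℕ
  isStoppingTime : IsStoppingTime (history X) τ
  recommend : (ℕ → X × ℝ) → Z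
  measurable_recommend : Measurable[isStoppingTime.measurableSpace] recommend

namespace Algorithm

variable {D : ℕ} {X Z : Finset (Vec D)}

/-- The pair (action, reward) of round `t`, after the observations `f` and with noise `u`: the
action `x` is chosen by the algorithm and the reward is `⟨θ, x⟩ + u`. -/
noncomputable def play (alg : Algorithm X Z) (θ : Vec D) (t : ℕ) (f : Fin t → X × ℝ) (u : ℝ) :
    X × ℝ :=
  (alg.arm t f, inner ℝ θ (alg.arm t f : Vec D) + u)

/-- The observations of the first `t` rounds under the parameter `θ` and the noise `ξ`. -/
noncomputable def observations (alg : Algorithm X Z) (θ : Vec D) (ξ : ℕ → ℝ) :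
    (t : ℕ) → (Fin t → X × ℝ)
  | 0 => Fin.elim0
  | t + 1 => Fin.snoc (alg.observations θ ξ t) (alg.play θ t (alg.observations θ ξ t) (ξ t))

/-- The whole trajectory of actions and rewards under the parameter `θ` and the noise `ξ`. -/
noncomputable def trajectory (alg : Algorithm X Z) (θ : Vec D) (ξ : ℕ → ℝ) : ℕ → X × ℝ :=
  fun t => alg.play θ t (alg.observations θ ξ t) (ξ t)

theorem trajectory_eq_observations (alg : Algorithm X Z) (θ : Vec D) (ξ : ℕ → ℝ) (t : ℕ) :
    (fun i : Fin t => alg.trajectory θ ξ i) = alg.observations θ ξ t := by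
  induction t with
  | zero => exact Subsingleton.elim _ _
  | succ t ih =>
    funext i
    refine Fin.lastCases ?_ (fun j => ?_) i
    · simp [observations, trajectory]
    · simpa [observations] using congrFun ih j

theorem measurable_play (alg : Algorithm X Z) (θ : Vec D) (t : ℕ) :
    Measurable fun p : (Fin t → X × ℝ) × ℝ => alg.play θ t p.1 p.2 := by
  have h : Measurable fun p : (Fin t → X × ℝ) × ℝ => alg.arm t p.1 :=
    (alg.measurable_arm t).comp measurable_fst
  have h' : Measurable fun x : X => inner ℝ θ (x : Vec D) :=
    (continuous_const.inner continuous_subtype_val).measurable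
  exact h.prodMk ((h'.comp h).add measurable_snd)

theorem measurable_observations (alg : Algorithm X Z) (θ : Vec D) (t : ℕ) :
    Measurable fun ξ : ℕ → ℝ => alg.observations θ ξ t := by
  induction t with
  | zero => exact measurable_const
  | succ t ih =>
    refine measurable_pi_lambda _ fun i => ?_
    refine Fin.lastCases ?_ (fun j => ?_) i
    · simpa [observations, Function.comp_def] using
        (alg.measurable_play θ t).comp (ih.prodMk (measurable_pi_apply t))
    · simpa [observations, Function.comp_def] using (measurable_pi_apply j).comp ih

theorem measurable_trajectory (alg : Algorithm X Z) (θ : Vec D) :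
    Measurable (alg.trajectory θ) :=
  measurable_pi_lambda _ fun t => (alg.measurable_play θ t).comp
    ((alg.measurable_observations θ t).prodMk (measurable_pi_apply t))

/-- `P_θ`: the law of the trajectory under the parameter `θ`, the noise being i.i.d. `N(0, 1)`. -/
noncomputable def law (alg : Algorithm X Z) (θ : Vec D) : Measure (ℕ → X × ℝ) :=
  (Measure.infinitePi fun _ : ℕ => gaussianReal 0 1).map (alg.trajectory θ)

instance (alg : Algorithm X Z) (θ : Vec D) : IsProbabilityMeasure (alg.law θ) :=
  Measure.isProbabilityMeasure_map (alg.measurable_trajectory θ).aemeasurable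

/-- The expected stopping time `E_θ[τ]`, which is `∞` if `τ = ∞` with positive probability. -/
noncomputable def expectedStoppingTime (alg : Algorithm X Z) (θ : Vec D) : ℝ≥0∞ :=
  ∫⁻ ω, ENat.toENNReal (alg.τ ω) ∂(alg.law θ)

end Algorithm

/-- The set of the optimal arms of `Z` for the parameter `θ`. -/
def optimalArms {D : ℕ} (Z : Finset (Vec D)) (θ : Vec D) : Set (Vec D) :=
  {z | z ∈ Z ∧ ∀ z' ∈ Z, inner ℝ θ z' ≤ inner ℝ θ z}

/-- The optimal arm for `θ` is unique. Targets that have the same reward for every parameter of the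
class `Θ` (for `Θ_d`: targets with the same truncation `ψ_d`) are not told apart here. -/
def UniqueOptimum {D : ℕ} (Z : Finset (Vec D)) (Θ : Set (Vec D)) (θ : Vec D) : Prop :=
  ∀ z ∈ optimalArms Z θ, ∀ z' ∈ optimalArms Z θ, ∀ η ∈ Θ, (inner ℝ η z : ℝ) = inner ℝ η z'

/-- `alg` is `δ`-PAC for `(X, Z, Θ)`: for every parameter of `Θ` with a unique optimal arm, it stops
and recommends the optimal arm with probability at least `1 - δ`. -/
def IsPAC {D : ℕ} {X Z : Finset (Vec D)} (alg : Algorithm X Z) (δ : ℝ) (Θ : Set (Vec D)) : Prop :=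
  ∀ θ ∈ Θ, UniqueOptimum Z Θ θ →
    1 - δ ≤ (alg.law θ).real
      {ω | alg.τ ω ≠ ⊤ ∧ (alg.recommend ω : Vec D) ∈ optimalArms Z θ}

end Algorithms

end LinearBandit

namespace LinearBandit

/-! An algorithm that is right under `θ` must tell `θ` apart from every parameter `θ'` of the class
under which another target beats `zs`. It may be assumed that `E_θ[τ]` is finite. Changing measure
at the stopping time (`setLIntegral_stoppedDensity`) gives a likelihood ratio whose logarithm has,
by Wald's identity (`integral_stoppedLogRatio`), the mean `∑ N_x ⟨θ - θ', x⟩² / 2` under `θ`, with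
`N_x` the expected number of plays of `x`. Recommending `zs` has probability at least `1 - δ` under
`θ` and at most `δ` under `θ'`, which forces this mean up to `(1 - 2δ) log((1 - δ)/δ)`
(`transportation`). Alternatives with tied optimal arms, about which the PAC property says nothing,
are limits of alternatives with a unique one (`le_sum_expectedPlays`).

If `E_θ[τ] > 0`, the weights `N_x / E_θ[τ]` form a design `l`. Write `y = ψ_d(zs) - ψ_d(z)` and let
`g` be the gap of `z`. Then `log_le_sum_expectedPlays` says that `log(1/(2.4δ)) ≤ E_θ[τ] · vᵀ A_d(l)
v` whenever `v · y = g`. Minimizing the quadratic form under this linear constraint gives `g² /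
‖y‖²_{A⁻¹}` if `y` is in the range of `A_d(l)`, and `0` otherwise, which is impossible as the
logarithm is positive. So this single design bounds the infimum defining the complexity by `E_θ[τ] /
log(1/(2.4δ))`. -/

/-- The law of the noise: i.i.d. standard Gaussians. -/
noncomputable abbrev noise : Measure (ℕ → ℝ) := Measure.infinitePi fun _ : ℕ => gaussianReal 0 1

/-! ### Change of measure over a fixed number of rounds -/

/-- Translation of a standard Gaussian, in terms of its density with respect to the original. -/
theorem lintegral_gaussianReal_shift (c : ℝ) {g : ℝ → ℝ≥0∞} (hg : Measurable g) :
    ∫⁻ u, g u ∂gaussianReal 0 1 =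
      ∫⁻ u, g (u + c) * ENNReal.ofReal (Real.exp (-(c * u + c ^ 2 / 2))) ∂gaussianReal 0 1 := by
  rw [gaussianReal_of_var_ne_zero _ one_ne_zero,
    lintegral_withDensity_eq_lintegral_mul _ (measurable_gaussianPDF 0 1) hg,
    lintegral_withDensity_eq_lintegral_mul _ (measurable_gaussianPDF 0 1) (by fun_prop),
    ← lintegral_add_right_eq_self _ c]
  refine lintegral_congr fun u => ?_
  simp only [Pi.mul_apply, gaussianPDF]
  rw [mul_left_comm, ← ENNReal.ofReal_mul (gaussianPDFReal_nonneg 0 1 u), mul_comm (g (u + c))]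
  congr 2
  simp only [gaussianPDFReal]
  rw [mul_assoc _ (Real.exp _), ← Real.exp_add]
  congr 2
  simp only [NNReal.coe_one]
  ring

namespace Algorithm

variable {D : ℕ} {X Z : Finset (Vec D)}

theorem observations_congr (alg : Algorithm X Z) (θ : Vec D) {ξ ξ' : ℕ → ℝ} {t : ℕ}
    (h : ∀ i < t, ξ i = ξ' i) : alg.observations θ ξ t = alg.observations θ ξ' t := by
  induction t with
  | zero => rfl
  | succ t ih =>
    simp only [observations]
    rw [ih fun i hi => h i (hi.trans t.lt_succ_self), h t t.lt_succ_self]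

/-- The first `t` observations are a function of the noise variables with index below `t` only, and
these are independent of the one with index `t`. -/
theorem indepFun_observations (alg : Algorithm X Z) (θ : Vec D) (t : ℕ) :
    IndepFun (fun ξ => alg.observations θ ξ t) (fun ξ => ξ t) noise := by
  have h : iIndepFun (fun i (ξ : ℕ → ℝ) => ξ i) noise :=
    iIndepFun_infinitePi (X := fun _ u => u) fun _ => measurable_id
  have h2 := h.indepFun_finset (Finset.range t) {t} (by simp) (fun i => measurable_pi_apply i)
  -- The missing noise is padded with `0`; by `observations_congr` the padding is never read.
  have hφ : Measurable fun (g : Finset.range t → ℝ) =>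
      alg.observations θ (fun i => if h : i ∈ Finset.range t then g ⟨i, h⟩ else 0) t := by
    refine (alg.measurable_observations θ t).comp (measurable_pi_lambda _ fun i => ?_)
    by_cases hi : i ∈ Finset.range t
    · simpa only [hi, dif_pos] using measurable_pi_apply _
    · simpa only [hi, dif_neg, not_false_eq_true] using measurable_const
  have hψ : Measurable fun (g : ({t} : Finset ℕ) → ℝ) => g ⟨t, Finset.mem_singleton_self t⟩ :=
    measurable_pi_apply _
  have h3 := h2.comp hφ hψ
  refine h3.congr (Filter.Eventually.of_forall fun ξ => ?_) (Filter.Eventually.of_forall fun ξ => rfl)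
  refine alg.observations_congr θ fun i hi => ?_
  simp [hi]

/-- By independence, the noise of round `t` can be integrated out with the past held fixed; this
drives the induction over rounds below. -/
theorem lintegral_observations (alg : Algorithm X Z) (θ : Vec D) (t : ℕ)
    {g : (Fin t → X × ℝ) × ℝ → ℝ≥0∞} (hg : Measurable g) :
    ∫⁻ ξ, g (alg.observations θ ξ t, ξ t) ∂noise =
      ∫⁻ ξ, ∫⁻ u, g (alg.observations θ ξ t, u) ∂gaussianReal 0 1 ∂noise := by
  have ho := alg.measurable_observations θ t
  have he : Measurable fun ξ : ℕ → ℝ => ξ t := measurable_pi_apply t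
  have h := (indepFun_iff_map_prod_eq_prod_map_map (μ := noise) ho.aemeasurable he.aemeasurable).1
    (alg.indepFun_observations θ t)
  rw [← lintegral_map (μ := noise) (f := g) (g := fun ξ => (alg.observations θ ξ t, ξ t)) hg
    (ho.prodMk he), h, lintegral_prod _ hg.aemeasurable, Measure.infinitePi_map_eval,
    lintegral_map hg.lintegral_prod_right' ho]

/-- The log-likelihood ratio of `θ` against `θ'` of a single observation. -/
noncomputable def logRatio (θ θ' : Vec D) (p : X × ℝ) : ℝ :=
  inner ℝ (θ - θ') (p.1 : Vec D) * (p.2 - inner ℝ θ (p.1 : Vec D)) +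
    inner ℝ (θ - θ') (p.1 : Vec D) ^ 2 / 2

theorem measurable_logRatio (θ θ' : Vec D) : Measurable (logRatio (X := X) θ θ') := by
  have h (η : Vec D) : Measurable fun p : X × ℝ => inner ℝ η (p.1 : Vec D) :=
    (continuous_const.inner (continuous_subtype_val.comp continuous_fst)).measurable
  exact ((h _).mul (measurable_snd.sub (h _))).add (((h _).pow_const 2).div_const 2)

/-- The density of a single observation under `θ'` with respect to that under `θ`. -/
noncomputable def density (θ θ' : Vec D) (p : X × ℝ) : ℝ≥0∞ :=
  ENNReal.ofReal (Real.exp (-logRatio θ θ' p))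

theorem measurable_density (θ θ' : Vec D) : Measurable (density (X := X) θ θ') :=
  (Real.measurable_exp.comp (measurable_logRatio θ θ').neg).ennreal_ofReal

/-- Change of measure on the first `t` observations. -/
theorem lintegral_observations_change (alg : Algorithm X Z) (θ θ' : Vec D) (t : ℕ)
    {f : (Fin t → X × ℝ) → ℝ≥0∞} (hf : Measurable f) :
    ∫⁻ ξ, f (alg.observations θ' ξ t) ∂noise =
      ∫⁻ ξ, f (alg.observations θ ξ t) * ∏ i, density θ θ' (alg.observations θ ξ t i) ∂noise := by
  induction t with
  | zero => simp [observations]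
  | succ t ih =>
    have hsnoc : Measurable fun p : (Fin t → X × ℝ) × (X × ℝ) =>
        (Fin.snoc p.1 p.2 : Fin (t + 1) → X × ℝ) := by
      refine measurable_pi_lambda _ fun i => ?_
      refine Fin.lastCases ?_ (fun j => ?_) i
      · simpa using measurable_snd
      · simpa [Function.comp_def] using (measurable_pi_apply j).comp measurable_fst
    have hg (η : Vec D) : Measurable fun p : (Fin t → X × ℝ) × ℝ =>
        (Fin.snoc p.1 (alg.play η t p.1 p.2) : Fin (t + 1) → X × ℝ) :=
      hsnoc.comp (measurable_fst.prodMk (alg.measurable_play η t))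
    have hprod (n : ℕ) : Measurable fun p : Fin n → X × ℝ => ∏ i, density θ θ' (p i) :=
      Finset.measurable_prod _ fun i _ => (measurable_density θ θ').comp (measurable_pi_apply i)
    simp only [observations]
    -- With the noise of the last round integrated out, the `θ'` side is the expectation of a
    -- function of the first `t` observations, to which the induction hypothesis applies.
    rw [alg.lintegral_observations θ' t
        (g := fun p => f (Fin.snoc p.1 (alg.play θ' t p.1 p.2))) (hf.comp (hg θ')),
      alg.lintegral_observations θ t (g := fun p =>
        f (Fin.snoc p.1 (alg.play θ t p.1 p.2)) * ∏ i : Fin (t + 1), density θ θ'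
          ((Fin.snoc p.1 (alg.play θ t p.1 p.2) : Fin (t + 1) → X × ℝ) i))
        ((hf.comp (hg θ)).mul ((hprod _).comp (hg θ))),
      ih (f := fun h => ∫⁻ u, f (Fin.snoc h (alg.play θ' t h u)) ∂gaussianReal 0 1)
        (hf.comp (hg θ')).lintegral_prod_right']
    refine lintegral_congr fun ξ => ?_
    set h := alg.observations θ ξ t
    have hF : Measurable fun u => f (Fin.snoc h (alg.play θ' t h u)) :=
      hf.comp ((hg θ').comp measurable_prodMk_left)
    simp only [Fin.prod_univ_castSucc, Fin.snoc_castSucc, Fin.snoc_last]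
    -- Given the past `h`, both parameters play the same arm `x`. Shifting the noise by `⟨θ - θ',
    -- x⟩` turns the reward under `θ'` into the reward under `θ`, and the density of the shift is
    -- that of the new observation.
    rw [lintegral_gaussianReal_shift (inner ℝ (θ - θ') (alg.arm t h : Vec D))
hF,
      ← lintegral_mul_const _ ?_]
    · refine lintegral_congr fun u => ?_
      have h1 : alg.play θ' t h (u + inner ℝ (θ - θ') (alg.arm t h : Vec D)) = alg.play θ t h u := by
        simp only [play, inner_sub_left]
        congr 1
        ring
      have h2 : logRatio θ θ' (alg.play θ t h u) =
          inner ℝ (θ - θ') (alg.arm t h : Vec D) * u +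
            inner ℝ (θ - θ') (alg.arm t h : Vec D) ^ 2 / 2 := by
        simp [logRatio, play]
      simp only [h1, density, h2]
      ring
    · exact (hF.comp (measurable_id.add_const _)).mul (by fun_prop)

end Algorithm

/-- A function that is almost everywhere the sum of a series of functions with summable `L¹` norms
is integrable, and its integral is the sum of the series of the integrals. -/
theorem integrable_and_hasSum_integral {α : Type*} [MeasurableSpace α] {μ : Measure α}
    {F : ℕ → α → ℝ} {L : α → ℝ} (hF : ∀ t, Integrable (F t) μ)
    (hsum : Summable fun t => ∫ a, ‖F t a‖ ∂μ) (hL : AEStronglyMeasurable L μ)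
    (hFL : ∀ᵐ a ∂μ, HasSum (fun t => F t a) (L a)) :
    Integrable L μ ∧ HasSum (fun t => ∫ a, F t a ∂μ) (∫ a, L a ∂μ) := by
  refine ⟨⟨hL, ?_⟩, ?_⟩
  · have h1 : ∫⁻ a, ‖L a‖ₑ ∂μ ≤ ∫⁻ a, ∑' t, ‖F t a‖ₑ ∂μ := by
      refine lintegral_mono_ae (hFL.mono fun a ha => ?_)
      rw [← ha.tsum_eq]
      exact enorm_tsum_le_tsum_enorm
    refine h1.trans_lt ?_
    rw [lintegral_tsum fun t => (hF t).aestronglyMeasurable.enorm]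
    have h2 (t : ℕ) : ∫⁻ a, ‖F t a‖ₑ ∂μ = ENNReal.ofReal (∫ a, ‖F t a‖ ∂μ) :=
      (ofReal_integral_norm_eq_lintegral_enorm (hF t)).symm
    simp only [h2]
    rw [← ENNReal.ofReal_tsum_of_nonneg (fun t => integral_nonneg fun a => norm_nonneg _) hsum]
    exact ENNReal.ofReal_lt_top
  · have h := hasSum_integral_of_summable_integral_norm hF hsum
    rwa [integral_congr_ae (hFL.mono fun a ha => ha.tsum_eq)] at h

/-! ### Change of measure at the stopping time -/

namespace Algorithm

variable {D : ℕ} {X Z : Finset (Vec D)}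

theorem measurableSet_of_history {t : ℕ} {A : Set (ℕ → X × ℝ)} (hA : MeasurableSet[history X t] A) :
    MeasurableSet A := (history X).le t A hA

/-- Rounds are numbered from `0`, so whether round `t` is played before stopping is known from the
`t` earlier observations, hence is independent of the noise of round `t`. -/
theorem measurableSet_lt_τ (alg : Algorithm X Z) (t : ℕ) :
    MeasurableSet[history X t] {ω | WithTop.some t < alg.τ ω} :=
  alg.isStoppingTime.measurableSet_gt t

theorem measurable_τ (alg : Algorithm X Z) : Measurable alg.τ := by
  refine measurable_to_countable' fun x => ?_
  induction x using WithTop.recTopCoe with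
  | top =>
    have : alg.τ ⁻¹' {⊤} = ⋂ t : ℕ, {ω | WithTop.some t < alg.τ ω} := by
      ext ω
      simp only [Set.mem_preimage, Set.mem_singleton_iff, Set.mem_iInter, Set.mem_ofPred_eq]
      exact WithTop.eq_top_iff_forall_gt
    rw [this]
    exact MeasurableSet.iInter fun t => measurableSet_of_history (alg.measurableSet_lt_τ t)
  | coe n => exact measurableSet_of_history (alg.isStoppingTime.measurableSet_eq n)

theorem law_apply_eq_setLIntegral (alg : Algorithm X Z) (θ θ' : Vec D) {t : ℕ}
    {A : Set (ℕ → X × ℝ)} (hA : MeasurableSet[history X t] A) :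
    alg.law θ' A = ∫⁻ ω in A, ∏ i ∈ Finset.range t, density θ θ' (ω i) ∂alg.law θ := by
  have hAm := measurableSet_of_history hA
  obtain ⟨B, hB, rfl⟩ := hA
  have hf : Measurable (B.indicator (1 : (Fin t → X × ℝ) → ℝ≥0∞)) := measurable_one.indicator hB
  have hd : Measurable fun ω : ℕ → X × ℝ => ∏ i ∈ Finset.range t, density θ θ' (ω i) :=
    Finset.measurable_prod _ fun i _ => (measurable_density θ θ').comp (measurable_pi_apply i)
  have key := alg.lintegral_observations_change θ θ' t hf
  rw [← lintegral_indicator hAm, ← lintegral_indicator_one hAm, law, law,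
    lintegral_map (measurable_one.indicator hAm) (alg.measurable_trajectory θ'),
    lintegral_map (hd.indicator hAm) (alg.measurable_trajectory θ)]
  have hmem (η : Vec D) (ξ : ℕ → ℝ) :
      alg.trajectory η ξ ∈ (fun (ω : ℕ → X × ℝ) (i : Fin t) => ω i) ⁻¹' B ↔
        alg.observations η ξ t ∈ B := by
    rw [← trajectory_eq_observations]
    rfl
  refine Eq.trans (lintegral_congr fun ξ => ?_) (key.trans (lintegral_congr fun ξ => ?_))
  · by_cases h : alg.observations θ' ξ t ∈ B
    · rw [Set.indicator_of_mem h, Set.indicator_of_mem ((hmem θ' ξ).2 h)]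
      rfl
    · rw [Set.indicator_of_notMem h, Set.indicator_of_notMem (mt (hmem θ' ξ).1 h)]
  · by_cases h : alg.observations θ ξ t ∈ B
    · rw [Set.indicator_of_mem h, Set.indicator_of_mem ((hmem θ ξ).2 h), Finset.prod_range,
        ← trajectory_eq_observations, Pi.one_apply, one_mul]
    · rw [Set.indicator_of_notMem h, Set.indicator_of_notMem (mt (hmem θ ξ).1 h), zero_mul]

/-- The likelihood ratio of `θ'` against `θ` at the stopping time. -/
noncomputable def stoppedDensity (alg : Algorithm X Z) (θ θ' : Vec D) (ω : ℕ → X × ℝ) : ℝ≥0∞ :=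
  ∏ i ∈ Finset.range ((alg.τ ω).untopD 0), density θ θ' (ω i)

/-- The log-likelihood ratio of `θ` against `θ'` at the stopping time. -/
noncomputable def stoppedLogRatio (alg : Algorithm X Z) (θ θ' : Vec D) (ω : ℕ → X × ℝ) : ℝ :=
  ∑ i ∈ Finset.range ((alg.τ ω).untopD 0), logRatio θ θ' (ω i)

theorem stoppedDensity_eq (alg : Algorithm X Z) (θ θ' : Vec D) (ω : ℕ → X × ℝ) :
    alg.stoppedDensity θ θ' ω = ENNReal.ofReal (Real.exp (-alg.stoppedLogRatio θ θ' ω)) := by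
  rw [stoppedDensity, stoppedLogRatio, ← Finset.sum_neg_distrib, Real.exp_sum,
    ENNReal.ofReal_prod_of_nonneg fun _ _ => (Real.exp_pos _).le]
  rfl

theorem measurable_τ_prodMk (alg : Algorithm X Z) :
    Measurable fun ω => ((alg.τ ω).untopD 0, ω) :=
  ((measurable_of_countable fun x : WithTop ℕ => x.untopD 0).comp alg.measurable_τ).prodMk
    measurable_id

theorem measurable_stoppedLogRatio (alg : Algorithm X Z) (θ θ' : Vec D) :
    Measurable (alg.stoppedLogRatio θ θ') := by
  have h1 (n : ℕ) : Measurable fun ω : ℕ → X × ℝ => ∑ i ∈ Finset.range n, logRatio θ θ' (ω i) :=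
    Finset.measurable_sum _ fun i _ =>
      (measurable_logRatio θ θ').comp (measurable_pi_apply i)
  have h2 : Measurable fun p : ℕ × (ℕ → X × ℝ) =>
      ∑ i ∈ Finset.range p.1, logRatio θ θ' (p.2 i) := measurable_from_prod_countable_right h1
  have h3 : Measurable ((fun p : ℕ × (ℕ → X × ℝ) =>
      ∑ i ∈ Finset.range p.1, logRatio θ θ' (p.2 i)) ∘ fun ω => ((alg.τ ω).untopD 0, ω)) :=
    h2.comp alg.measurable_τ_prodMk
  exact h3

/-- Change of measure at the stopping time. -/
theorem setLIntegral_stoppedDensity (alg : Algorithm X Z) (θ θ' : Vec D) {S : Set (ℕ → X × ℝ)}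
    (hS : MeasurableSet[alg.isStoppingTime.measurableSpace] S) :
    ∫⁻ ω in {ω | alg.τ ω ≠ ⊤ ∧ ω ∈ S}, alg.stoppedDensity θ θ' ω ∂alg.law θ =
      alg.law θ' {ω | alg.τ ω ≠ ⊤ ∧ ω ∈ S} := by
  -- On `S ∩ {τ = t}`, an event of the first `t` rounds because `S` belongs to the stopped
  -- `σ`-algebra, the stopped density is the fixed-time one. Excluding `τ = ⊤` keeps out the default
  -- value of `untopD`.
  have hU : {ω | alg.τ ω ≠ ⊤ ∧ ω ∈ S} = ⋃ t : ℕ, S ∩ {ω | alg.τ ω = WithTop.some t} := by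
    ext ω
    simp only [Set.mem_ofPred_eq, Set.mem_iUnion, Set.mem_inter_iff, WithTop.ne_top_iff_exists]
    constructor
    · rintro ⟨⟨t, ht⟩, h⟩
      exact ⟨t, h, ht.symm⟩
    · rintro ⟨t, h, ht⟩
      exact ⟨⟨t, ht.symm⟩, h⟩
  have hm (t : ℕ) : MeasurableSet[history X t] (S ∩ {ω | alg.τ ω = WithTop.some t}) := by
    refine (alg.isStoppingTime.measurableSet_inter_eq_iff S t).1 (hS.inter ?_)
    have := (alg.isStoppingTime.measurableSet_inter_eq_iff Set.univ t).2
    simp only [Set.univ_inter] at this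
    exact this (alg.isStoppingTime.measurableSet_eq t)
  have hd : Pairwise (Function.onFun Disjoint fun t : ℕ => S ∩ {ω | alg.τ ω = WithTop.some t}) := by
    intro s t hst
    refine Set.disjoint_left.2 fun ω h h' => hst ?_
    exact WithTop.coe_injective (h.2.symm.trans h'.2)
  rw [hU, lintegral_iUnion (fun t => measurableSet_of_history (hm t)) hd,
    measure_iUnion hd fun t => measurableSet_of_history (hm t)]
  refine tsum_congr fun t => ?_
  rw [alg.law_apply_eq_setLIntegral θ θ' (hm t)]
  refine setLIntegral_congr_fun (measurableSet_of_history (hm t)) fun ω hω => ?_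
  have : alg.τ ω = WithTop.some t := hω.2
  simp only [stoppedDensity, this, WithTop.untopD_coe]

theorem toENNReal_eq_tsum (n : WithTop ℕ) :
    ENat.toENNReal n = ∑' t : ℕ, if WithTop.some t < n then 1 else 0 := by
  induction n using WithTop.recTopCoe with
  | top =>
    have h (t : ℕ) : WithTop.some t < ⊤ := WithTop.coe_lt_top t
    simp only [h, if_true]
    rw [ENNReal.tsum_const_eq_top_of_ne_zero one_ne_zero]
    rfl
  | coe n =>
    rw [tsum_eq_sum (s := Finset.range n)]
    · rw [Finset.sum_congr rfl (g := fun _ => 1)]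
      · simp only [Finset.sum_const, Finset.card_range, nsmul_one]
        rfl
      · intro t ht
        rw [if_pos (WithTop.coe_lt_coe.2 (Finset.mem_range.1 ht))]
    · intro t ht
      rw [if_neg]
      intro h
      exact ht (Finset.mem_range.2 (WithTop.coe_lt_coe.1 h))

/-- The tail-sum formula: it expresses the expectation through the events `t < τ`, each of which is
decided before round `t`. -/
theorem expectedStoppingTime_eq_tsum (alg : Algorithm X Z) (θ : Vec D) :
    alg.expectedStoppingTime θ = ∑' t : ℕ, alg.law θ {ω | WithTop.some t < alg.τ ω} := by
  have hm (t : ℕ) := measurableSet_of_history (alg.measurableSet_lt_τ t)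
  simp only [expectedStoppingTime, toENNReal_eq_tsum]
  rw [lintegral_tsum fun t => (Measurable.ite (hm t) measurable_const measurable_const).aemeasurable]
  refine tsum_congr fun t => ?_
  rw [← lintegral_indicator_one (hm t)]
  refine lintegral_congr fun ω => ?_
  simp only [Set.indicator_apply, Set.mem_ofPred_eq, Pi.one_apply]

theorem summable_law_lt_τ (alg : Algorithm X Z) {θ : Vec D} (h : alg.expectedStoppingTime θ ≠ ∞) :
    Summable fun t : ℕ => (alg.law θ).real {ω | WithTop.some t < alg.τ ω} := by
  rw [expectedStoppingTime_eq_tsum] at h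
  exact ENNReal.summable_toReal h

theorem ae_τ_ne_top (alg : Algorithm X Z) {θ : Vec D} (h : alg.expectedStoppingTime θ ≠ ∞) :
    ∀ᵐ ω ∂alg.law θ, alg.τ ω ≠ ⊤ := by
  have hm : Measurable fun ω => ENat.toENNReal (alg.τ ω) :=
    (measurable_of_countable (fun x : WithTop ℕ => ENat.toENNReal x)).comp alg.measurable_τ
  refine (ae_lt_top hm h).mono fun ω hω h' => ?_
  rw [h'] at hω
  exact absurd hω (by simp [show (⊤ : WithTop ℕ) = (⊤ : ℕ∞) from rfl])

/-! ### Wald's identity -/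

/-- A constant `K` with `E_θ[|logRatio θ θ' (ω t)| 1_A] ≤ K P_θ(A)` for all `t` and all events `A`
of the first `t` rounds. -/
noncomputable def logRatioBound (X : Finset (Vec D)) (θ θ' : Vec D) : ℝ :=
  (∑ x : X, |inner ℝ (θ - θ') (x : Vec D)|) * (∫ u, |u| ∂gaussianReal 0 1) +
    (∑ x : X, |inner ℝ (θ - θ') (x : Vec D)|) ^ 2 / 2

/-- Under `θ` the log-ratio of round `t` is `c ξ_t + c² / 2`, where `c = ⟨θ - θ', x⟩` for the arm
`x` played. Both `A` and `c` depend on the past only, so the first term has mean zero by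
independence, and only the squares remain. -/
theorem integral_indicator_logRatio (alg : Algorithm X Z) (θ θ' : Vec D) {t : ℕ}
    {A : Set (ℕ → X × ℝ)} (hA : MeasurableSet[history X t] A) :
    Integrable (A.indicator fun ω => logRatio θ θ' (ω t)) (alg.law θ) ∧
    ∫ ω, ‖A.indicator (fun ω => logRatio θ θ' (ω t)) ω‖ ∂alg.law θ ≤
      logRatioBound X θ θ' * (alg.law θ).real A ∧
    ∫ ω, A.indicator (fun ω => logRatio θ θ' (ω t)) ω ∂alg.law θ =
      ∑ x : X, (alg.law θ).real (A ∩ {ω | (ω t).1 = x}) *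
        (inner ℝ (θ - θ') (x : Vec D) ^ 2 / 2) := by
  classical
  have hAm := measurableSet_of_history hA
  obtain ⟨B, hB, rfl⟩ := hA
  set A := (fun (ω : ℕ → X × ℝ) (i : Fin t) => ω i) ⁻¹' B with hAdef
  set C : ℝ := ∑ x : X, |inner ℝ (θ - θ') (x : Vec D)| with hC
  have hC0 : 0 ≤ C := Finset.sum_nonneg fun x _ => abs_nonneg _
  have hxC (x : X) : |inner ℝ (θ - θ') (x : Vec D)| ≤ C :=
    Finset.single_le_sum (f := fun x : X => |inner ℝ (θ - θ') (x : Vec D)|)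
      (fun x _ => abs_nonneg _) (Finset.mem_univ x)
  set T := alg.trajectory θ with hT
  have hTm : Measurable T := alg.measurable_trajectory θ
  have hom := alg.measurable_observations θ t
  have hmem (ξ : ℕ → ℝ) : T ξ ∈ A ↔ alg.observations θ ξ t ∈ B := by
    rw [← trajectory_eq_observations]
    rfl
  have hcm : Measurable fun x : X => (inner ℝ (θ - θ') (x : Vec D) : ℝ) :=
    (continuous_const.inner continuous_subtype_val).measurable
  set G : (Fin t → X × ℝ) → ℝ := B.indicator fun h => inner ℝ (θ - θ') (alg.arm t h : Vec D) with hG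
  have hGm : Measurable G := (hcm.comp (alg.measurable_arm t)).indicator hB
  have hGC (h : Fin t → X × ℝ) : |G h| ≤ B.indicator (fun _ => C) h := by
    by_cases hh : h ∈ B
    · simpa [hG, hh] using hxC (alg.arm t h)
    · simp [hG, hh]
  have hGC' (h : Fin t → X × ℝ) : |G h| ≤ C :=
    (hGC h).trans (Set.indicator_le_self' (fun _ _ => hC0) h)
  have hf (ξ : ℕ → ℝ) : A.indicator (fun ω => logRatio θ θ' (ω t)) (T ξ) =
      G (alg.observations θ ξ t) * ξ t + G (alg.observations θ ξ t) ^ 2 / 2 := by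
    by_cases h : alg.observations θ ξ t ∈ B
    · rw [Set.indicator_of_mem ((hmem ξ).2 h)]
      simp [hG, h, hT, trajectory, play, logRatio]
    · rw [Set.indicator_of_notMem (mt (hmem ξ).1 h)]
      simp [hG, h]
  have hid : Integrable (fun u : ℝ => u) (gaussianReal 0 1) :=
    (memLp_id_gaussianReal 1).integrable (by simp)
  have hev : MeasurePreserving (fun ξ : ℕ → ℝ => ξ t) noise (gaussianReal 0 1) :=
    measurePreserving_eval_infinitePi _ t
  have hξ : Integrable (fun ξ : ℕ → ℝ => ξ t) noise := hev.integrable_comp_of_integrable hid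
  have hGi : Integrable (fun ξ => G (alg.observations θ ξ t)) noise :=
    Integrable.of_bound (hGm.comp hom).aestronglyMeasurable C
      (Filter.Eventually.of_forall fun ξ => hGC' _)
  have hG2i : Integrable (fun ξ => G (alg.observations θ ξ t) ^ 2 / 2) noise := by
    refine Integrable.of_bound (((hGm.comp hom).pow_const 2).div_const 2).aestronglyMeasurable
      (C ^ 2 / 2) (Filter.Eventually.of_forall fun ξ => ?_)
    rw [Real.norm_of_nonneg (by positivity)]
    have := sq_le_sq' (by linarith [abs_le.1 (hGC' (alg.observations θ ξ t))])
      (abs_le.1 (hGC' (alg.observations θ ξ t))).2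
    linarith
  have hind : IndepFun (fun ξ => G (alg.observations θ ξ t)) (fun ξ => ξ t) noise :=
    (alg.indepFun_observations θ t).comp hGm measurable_id
  have hprod : Integrable (fun ξ => G (alg.observations θ ξ t) * ξ t) noise :=
    hind.integrable_mul hGi hξ
  have hlm : Measurable (A.indicator fun ω => logRatio θ θ' (ω t)) :=
    ((measurable_logRatio θ θ').comp (measurable_pi_apply t)).indicator hAm
  have hPA : (alg.law θ).real A = ∫ ξ, B.indicator (fun _ => (1 : ℝ)) (alg.observations θ ξ t) ∂noise := by
    rw [← integral_indicator_one hAm, law, integral_map hTm.aemeasurable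
      (measurable_one.indicator hAm).aestronglyMeasurable]
    refine integral_congr_ae (Filter.Eventually.of_forall fun ξ => ?_)
    by_cases h : alg.observations θ ξ t ∈ B
    · simp only
      rw [Set.indicator_of_mem h, Set.indicator_of_mem ((hmem ξ).2 h), Pi.one_apply]
    · simp only
      rw [Set.indicator_of_notMem h, Set.indicator_of_notMem (mt (hmem ξ).1 h)]
  have hBi (c : ℝ) : Integrable (fun ξ => B.indicator (fun _ => c) (alg.observations θ ξ t)) noise :=
    Integrable.of_bound ((measurable_const.indicator hB).comp hom).aestronglyMeasurable |c|
      (Filter.Eventually.of_forall fun ξ => norm_indicator_le_norm_self _ _)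
  have hBc (c : ℝ) : ∫ ξ, B.indicator (fun _ => c) (alg.observations θ ξ t) ∂noise =
      c * (alg.law θ).real A := by
    rw [hPA, ← integral_const_mul]
    refine integral_congr_ae (Filter.Eventually.of_forall fun ξ => ?_)
    simp only [Set.indicator_apply]
    split_ifs <;> simp
  refine ⟨?_, ?_, ?_⟩
  · rw [law, integrable_map_measure hlm.aestronglyMeasurable hTm.aemeasurable]
    exact (hprod.add hG2i).congr (Filter.Eventually.of_forall fun ξ => (hf ξ).symm)
  · rw [law, integral_map hTm.aemeasurable hlm.norm.aestronglyMeasurable]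
    have habs : IndepFun (fun ξ => |G (alg.observations θ ξ t)|) (fun ξ => |ξ t|) noise :=
      (alg.indepFun_observations θ t).comp hGm.abs measurable_id.abs
    have hprod' : Integrable (fun ξ => |G (alg.observations θ ξ t)| * |ξ t|) noise :=
      habs.integrable_mul hGi.abs hξ.abs
    have hle1 : ∫ ξ, |G (alg.observations θ ξ t)| ∂noise ≤ C * (alg.law θ).real A := by
      rw [← hBc]
      exact integral_mono hGi.abs (hBi C) fun ξ => hGC _
    have hle2 : ∫ ξ, G (alg.observations θ ξ t) ^ 2 / 2 ∂noise ≤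
        C ^ 2 / 2 * (alg.law θ).real A := by
      rw [← hBc]
      refine integral_mono hG2i (hBi _) fun ξ => ?_
      have h1 := hGC (alg.observations θ ξ t)
      simp only [Set.indicator_apply] at h1 ⊢
      split_ifs at h1 ⊢
      · have := sq_le_sq' (by linarith [abs_le.1 h1]) (abs_le.1 h1).2
        linarith
      · have := abs_nonpos_iff.1 h1
        simp [this]
    calc ∫ ξ, ‖A.indicator (fun ω => logRatio θ θ' (ω t)) (T ξ)‖ ∂noise
        ≤ ∫ ξ, (|G (alg.observations θ ξ t)| * |ξ t| + G (alg.observations θ ξ t) ^ 2 / 2) ∂noise := by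
          refine integral_mono_of_nonneg (Filter.Eventually.of_forall fun ξ => norm_nonneg _)
            (hprod'.add hG2i) (Filter.Eventually.of_forall fun ξ => ?_)
          simp only [hf, Real.norm_eq_abs]
          refine (abs_add_le _ _).trans ?_
          rw [abs_mul, abs_of_nonneg (a := G _ ^ 2 / 2) (by positivity)]
      _ = (∫ ξ, |G (alg.observations θ ξ t)| ∂noise) * (∫ u, |u| ∂gaussianReal 0 1) +
          ∫ ξ, G (alg.observations θ ξ t) ^ 2 / 2 ∂noise := by
          rw [integral_add hprod' hG2i,
            habs.integral_fun_mul_eq_mul_integral hGi.abs.1 hξ.abs.1, ← hev.map_eq,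
            integral_map (f := fun u : ℝ => |u|) hev.measurable.aemeasurable
              measurable_id.abs.aestronglyMeasurable]
      _ ≤ C * (alg.law θ).real A * (∫ u, |u| ∂gaussianReal 0 1) +
          C ^ 2 / 2 * (alg.law θ).real A := by
          gcongr
      _ = logRatioBound X θ θ' * (alg.law θ).real A := by
          simp only [logRatioBound, ← hC]
          ring
  · have h0 : ∫ ξ, ξ t ∂noise = 0 := by
      have := integral_map (μ := noise) (f := fun u : ℝ => u) hev.measurable.aemeasurable
        measurable_id.aestronglyMeasurable
      rw [← this, hev.map_eq, integral_id_gaussianReal]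
    have hx (x : X) : MeasurableSet (A ∩ {ω | (ω t).1 = x}) :=
      hAm.inter (measurable_fst.comp (measurable_pi_apply t) (measurableSet_singleton x))
    have hsum : ∑ x : X, (alg.law θ).real (A ∩ {ω | (ω t).1 = x}) *
        (inner ℝ (θ - θ') (x : Vec D) ^ 2 / 2) = ∫ ω, ∑ x : X,
          (A ∩ {ω | (ω t).1 = x}).indicator (fun _ => inner ℝ (θ - θ') (x : Vec D) ^ 2 / 2) ω
            ∂alg.law θ := by
      rw [integral_finsetSum _ fun x _ => (integrable_const _).indicator (hx x)]
      refine Finset.sum_congr rfl fun x _ => ?_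
      rw [integral_indicator_const _ (hx x), smul_eq_mul]
    rw [hsum, law, integral_map hTm.aemeasurable hlm.aestronglyMeasurable,
      integral_map hTm.aemeasurable (Finset.measurable_sum _ fun x _ =>
        measurable_const.indicator (hx x)).aestronglyMeasurable]
    simp only [hf]
    rw [integral_add hprod hG2i, hind.integral_fun_mul_eq_mul_integral hGi.1 hξ.1, h0, mul_zero,
      zero_add]
    refine integral_congr_ae (Filter.Eventually.of_forall fun ξ => ?_)
    simp only [Set.indicator_apply, Set.mem_inter_iff, hmem, Set.mem_ofPred_eq, hG]
    by_cases h : alg.observations θ ξ t ∈ B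
    · simp [h, hT, trajectory, play]
    · simp [h]

/-- The expected number of plays of the action `x` before the stopping time. -/
noncomputable def expectedPlays (alg : Algorithm X Z) (θ : Vec D) (x : X) : ℝ :=
  ∑' t : ℕ, (alg.law θ).real ({ω | WithTop.some t < alg.τ ω} ∩ {ω | (ω t).1 = x})

theorem summable_expectedPlays (alg : Algorithm X Z) {θ : Vec D}
    (h : alg.expectedStoppingTime θ ≠ ∞) (x : X) :
    Summable fun t : ℕ =>
      (alg.law θ).real ({ω | WithTop.some t < alg.τ ω} ∩ {ω | (ω t).1 = x}) :=
  (alg.summable_law_lt_τ h).of_nonneg_of_le (fun _ => measureReal_nonneg)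
    fun _ => measureReal_mono Set.inter_subset_left

theorem expectedPlays_nonneg (alg : Algorithm X Z) (θ : Vec D) (x : X) :
    0 ≤ alg.expectedPlays θ x := tsum_nonneg fun _ => measureReal_nonneg

/-- Each round played before stopping uses exactly one arm. -/
theorem sum_expectedPlays (alg : Algorithm X Z) {θ : Vec D}
    (h : alg.expectedStoppingTime θ ≠ ∞) :
    ∑ x : X, alg.expectedPlays θ x = (alg.expectedStoppingTime θ).toReal := by
  simp only [expectedPlays]
  rw [← Summable.tsum_finsetSum fun x _ => alg.summable_expectedPlays h x,
    expectedStoppingTime_eq_tsum, ENNReal.tsum_toReal_eq fun t => measure_ne_top _ _]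
  refine tsum_congr fun t => ?_
  have hx (x : X) : MeasurableSet ({ω | WithTop.some t < alg.τ ω} ∩ {ω | (ω t).1 = x}) :=
    (measurableSet_of_history (alg.measurableSet_lt_τ t)).inter
      (measurable_fst.comp (measurable_pi_apply t) (measurableSet_singleton x))
  rw [← measureReal_def, ← measureReal_biUnion_finset _ fun x _ => hx x]
  · congr 1
    ext ω
    simp
  · intro x _ y _ hxy
    refine Set.disjoint_left.2 fun ω h h' => hxy (h.2.symm.trans h'.2)

/-- Wald's identity for the log-likelihood ratio at the stopping time. -/
theorem integral_stoppedLogRatio (alg : Algorithm X Z) (θ θ' : Vec D)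
    (h : alg.expectedStoppingTime θ ≠ ∞) :
    Integrable (alg.stoppedLogRatio θ θ') (alg.law θ) ∧
    ∫ ω, alg.stoppedLogRatio θ θ' ω ∂alg.law θ =
      ∑ x : X, alg.expectedPlays θ x * (inner ℝ (θ - θ') (x : Vec D) ^ 2 / 2) := by
  have hstep (t : ℕ) := alg.integral_indicator_logRatio θ θ' (alg.measurableSet_lt_τ t)
  -- The random-length sum is rewritten as a series over all rounds with indicators of `t < τ`; it
  -- has finitely many nonzero terms wherever `τ` is finite.
  have hs : ∀ᵐ ω ∂alg.law θ, HasSum (fun t => {ω | WithTop.some t < alg.τ ω}.indicator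
      (fun ω => logRatio θ θ' (ω t)) ω) (alg.stoppedLogRatio θ θ' ω) := by
    refine (alg.ae_τ_ne_top h).mono fun ω hω => ?_
    obtain ⟨n, hn⟩ := WithTop.ne_top_iff_exists.1 hω
    have h1 : alg.stoppedLogRatio θ θ' ω = ∑ t ∈ Finset.range n,
        {ω | WithTop.some t < alg.τ ω}.indicator (fun ω => logRatio θ θ' (ω t)) ω := by
      rw [stoppedLogRatio, ← hn, WithTop.untopD_coe]
      refine Finset.sum_congr rfl fun t ht => ?_
      rw [Set.indicator_of_mem]
      simpa [← hn, WithTop.coe_lt_coe] using ht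
    rw [h1]
    refine hasSum_sum_of_ne_finset_zero fun t ht => Set.indicator_of_notMem (fun h' => ht ?_) _
    rw [Set.mem_ofPred_eq, ← hn, WithTop.coe_lt_coe] at h'
    exact Finset.mem_range.2 h'
  -- The `L¹` norms are at most a constant times `P_θ(t < τ)`, and these probabilities sum to the
  -- finite `E_θ[τ]`.
  obtain ⟨h1, h2⟩ := integrable_and_hasSum_integral (fun t => (hstep t).1)
    (((alg.summable_law_lt_τ h).mul_left _).of_nonneg_of_le
      (fun t => integral_nonneg fun _ => norm_nonneg _) fun t => (hstep t).2.1)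
    (alg.measurable_stoppedLogRatio θ θ').aestronglyMeasurable hs
  refine ⟨h1, h2.unique ?_⟩
  simp only [(hstep _).2.2]
  exact hasSum_sum fun x _ => (alg.summable_expectedPlays h x).hasSum.mul_right _

/-! ### Transportation inequality -/

/-- The transportation inequality between `θ` and `θ'`: an event of the stopped observations that
has probability at least `1 - δ` under `θ` and at most `δ` under `θ'` forces many plays. -/
theorem transportation (alg : Algorithm X Z) (θ θ' : Vec D)
    (h : alg.expectedStoppingTime θ ≠ ∞) {S : Set (ℕ → X × ℝ)}
    (hS : MeasurableSet[alg.isStoppingTime.measurableSpace] S) {δ : ℝ} (hδ : 0 < δ) (hδ2 : δ ≤ 1 / 2)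
    (h1 : 1 - δ ≤ (alg.law θ).real {ω | alg.τ ω ≠ ⊤ ∧ ω ∈ S})
    (h2 : (alg.law θ').real {ω | alg.τ ω ≠ ⊤ ∧ ω ∈ S} ≤ δ) :
    (1 - 2 * δ) * Real.log ((1 - δ) / δ) ≤
      ∑ x : X, alg.expectedPlays θ x * (inner ℝ (θ - θ') (x : Vec D) ^ 2 / 2) := by
  obtain ⟨hLi, hLeq⟩ := alg.integral_stoppedLogRatio θ θ' h
  rw [← hLeq]
  set L := alg.stoppedLogRatio θ θ' with hL
  have hLm : Measurable L := alg.measurable_stoppedLogRatio θ θ'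
  have hSm : MeasurableSet S := alg.isStoppingTime.measurableSpace_le S hS
  have htop : MeasurableSet {ω | alg.τ ω ≠ ⊤} :=
    (alg.measurable_τ (measurableSet_singleton ⊤)).compl
  have hreal (V : Set (ℕ → X × ℝ)) (hV : MeasurableSet[alg.isStoppingTime.measurableSpace] V) :
      IntegrableOn (fun ω => Real.exp (-L ω)) V (alg.law θ) ∧
        ∫ ω in V, Real.exp (-L ω) ∂alg.law θ = (alg.law θ').real {ω | alg.τ ω ≠ ⊤ ∧ ω ∈ V} := by
    have hae : V =ᵐ[alg.law θ] {ω | alg.τ ω ≠ ⊤ ∧ ω ∈ V} := by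
      filter_upwards [alg.ae_τ_ne_top h] with ω hω
      exact propext ⟨fun hv => ⟨hω, hv⟩, fun hv => hv.2⟩
    have hc := alg.setLIntegral_stoppedDensity θ θ' hV
    simp only [stoppedDensity_eq, ← hL] at hc
    have hm : AEStronglyMeasurable (fun ω => Real.exp (-L ω)) ((alg.law θ).restrict V) :=
      (Real.measurable_exp.comp hLm.neg).aestronglyMeasurable
    rw [← setLIntegral_congr hae] at hc
    refine ⟨⟨hm, ?_⟩, ?_⟩
    · rw [hasFiniteIntegral_iff_ofReal (Filter.Eventually.of_forall fun ω => (Real.exp_pos _).le), hc]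
      exact measure_lt_top _ _
    · rw [integral_eq_lintegral_of_nonneg_ae
        (Filter.Eventually.of_forall fun ω => (Real.exp_pos _).le) hm, hc, measureReal_def]
  obtain ⟨hi1, he1⟩ := hreal S hS
  obtain ⟨hi2, he2⟩ := hreal Sᶜ hS.compl
  set q := (alg.law θ').real {ω | alg.τ ω ≠ ⊤ ∧ ω ∈ S} with hq
  set q' := (alg.law θ').real {ω | alg.τ ω ≠ ⊤ ∧ ω ∈ Sᶜ} with hq'
  -- Only an inequality: under `θ'` the algorithm may fail to stop.
  have hqq : q + q' ≤ 1 := by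
    rw [hq, hq', ← measureReal_union]
    · exact measureReal_le_one
    · exact Set.disjoint_left.2 fun ω h h' => h'.2 h.2
    · exact htop.inter hSm.compl
  have hp : 1 - δ ≤ (alg.law θ).real S := h1.trans (measureReal_mono fun ω hω => hω.2)
  have hp1 : (alg.law θ).real Sᶜ = 1 - (alg.law θ).real S := probReal_compl_eq_one_sub hSm
  set p := (alg.law θ).real S
  -- The tangent inequality `log u ≤ u - 1` at `u = a exp(-L)`. With a suitable constant `a` on each
  -- of `S` and `Sᶜ`, it replaces convexity of the relative entropy.
  have hpoint {a : ℝ} (ha : 0 < a) (ω : ℕ → X × ℝ) :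
      Real.log a + 1 - a * Real.exp (-L ω) ≤ L ω := by
    have := Real.log_le_sub_one_of_pos (mul_pos ha (Real.exp_pos (-L ω)))
    rw [Real.log_mul ha.ne' (Real.exp_pos _).ne', Real.log_exp] at this
    linarith
  have hint {V : Set (ℕ → X × ℝ)} (hi : IntegrableOn (fun ω => Real.exp (-L ω)) V (alg.law θ))
      {a : ℝ} (ha : 0 < a) :
      (alg.law θ).real V * (Real.log a + 1) - a * ∫ ω in V, Real.exp (-L ω) ∂alg.law θ ≤
        ∫ ω in V, L ω ∂alg.law θ := by
    have hc : ∫ ω in V, (Real.log a + 1) ∂alg.law θ = (alg.law θ).real V * (Real.log a + 1) := by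
      rw [setIntegral_const, smul_eq_mul]
    rw [← hc, ← integral_const_mul, ← integral_sub (integrable_const _) (hi.const_mul a)]
    exact integral_mono ((integrable_const _).sub (hi.const_mul a)) hLi.integrableOn
      fun ω => hpoint ha ω
  -- These multipliers are the likelihood ratios in the extreme case `p = 1 - δ`, `q = δ`, where the
  -- correction terms `a q + b (1 - q)` add up to exactly `1` and cancel the constants.
  have ha : 0 < (1 - δ) / δ := div_pos (by linarith) hδ
  have hb : 0 < δ / (1 - δ) := div_pos hδ (by linarith)
  have k1 := hint hi1 ha
  have k2 := hint hi2 hb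
  rw [he1] at k1
  rw [he2, hp1] at k2
  rw [← integral_add_compl hSm hLi]
  have hlog : Real.log (δ / (1 - δ)) = -Real.log ((1 - δ) / δ) := by
    rw [← Real.log_inv, inv_div]
  have hl0 : 0 ≤ Real.log ((1 - δ) / δ) :=
    Real.log_nonneg ((one_le_div hδ).2 (by linarith))
  have hab : δ / (1 - δ) ≤ (1 - δ) / δ := by
    rw [div_le_div_iff₀ (by linarith) hδ]
    nlinarith
  rw [hlog] at k2
  have e1 : (1 - δ) / δ * δ = 1 - δ := div_mul_cancel₀ _ hδ.ne'
  have e2 : δ / (1 - δ) * (1 - δ) = δ := div_mul_cancel₀ _ (by linarith)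
  have hq0 : δ / (1 - δ) * q' ≤ δ / (1 - δ) * (1 - q) :=
    mul_le_mul_of_nonneg_left (by linarith) hb.le
  have hq1 : ((1 - δ) / δ - δ / (1 - δ)) * q ≤ ((1 - δ) / δ - δ / (1 - δ)) * δ :=
    mul_le_mul_of_nonneg_left h2 (by linarith)
  have hp2 : (1 - 2 * δ) * Real.log ((1 - δ) / δ) ≤ (2 * p - 1) * Real.log ((1 - δ) / δ) :=
    mul_le_mul_of_nonneg_right (by linarith) hl0
  linarith

end Algorithm

/-! ### Generic uniqueness of the optimal arm -/

open Filter Topology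

theorem add_smul_mem_paramClass {D d : ℕ} {θ η : Vec D} (hθ : θ ∈ paramClass D d)
    (hη : η ∈ paramClass D d) (s : ℝ) : θ + s • η ∈ paramClass D d := by
  intro i hi
  simp [hθ i hi, hη i hi]

/-- A nonzero affine function has at most one zero. The neighbourhood is punctured because that zero
may be `0` itself. -/
theorem eventually_add_mul_ne_zero (a b : ℝ) (h : a ≠ 0 ∨ b ≠ 0) :
    ∀ᶠ s in 𝓝[≠] (0 : ℝ), a + s * b ≠ 0 := by
  by_cases hb : b = 0
  · simpa [hb] using h
  have h1 : ∀ᶠ s in 𝓝[≠] (0 : ℝ), s ≠ -a / b := by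
    by_cases h0 : -a / b = 0
    · rw [h0]
      exact self_mem_nhdsWithin
    · exact (eventually_ne_nhds (Ne.symm h0)).filter_mono nhdsWithin_le_nhds
  filter_upwards [h1] with s hs h'
  exact hs (by rw [eq_div_iff hb]; linarith)

/-- Finitely many proper subspaces do not cover `Θ_d`: a small nonzero step towards a vector that is
good for `w` preserves the nonvanishing already achieved. -/
theorem exists_forall_inner_ne_zero {D d : ℕ} (S : Finset (Vec D))
    (h : ∀ v ∈ S, ∃ η ∈ paramClass D d, (inner ℝ η v : ℝ) ≠ 0) :
    ∃ η ∈ paramClass D d, ∀ v ∈ S, (inner ℝ η v : ℝ) ≠ 0 := by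
  classical
  induction S using Finset.induction_on with
  | empty => exact ⟨0, fun i _ => rfl, by simp⟩
  | insert w S _ ih =>
    obtain ⟨η, hη, hS⟩ := ih fun v hv => h v (Finset.mem_insert_of_mem hv)
    obtain ⟨η', hη', hw⟩ := h w (Finset.mem_insert_self w S)
    have hev : ∀ᶠ s in 𝓝[≠] (0 : ℝ), ∀ v ∈ insert w S, (inner ℝ (η + s • η') v : ℝ) ≠ 0 := by
      rw [eventually_all_finset]
      intro v hv
      simp only [inner_add_left, real_inner_smul_left]
      refine eventually_add_mul_ne_zero _ _ ?_
      rcases Finset.mem_insert.1 hv with rfl | hv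
      · exact Or.inr hw
      · exact Or.inl (hS v hv)
    obtain ⟨s, hs⟩ := hev.exists
    exact ⟨η + s • η', add_smul_mem_paramClass hη hη' s, hs⟩

/-- Along a suitable line through any parameter, the optimal arm is generically unique. -/
theorem exists_eventually_uniqueOptimum {D : ℕ} (d : ℕ) (Z : Finset (Vec D)) :
    ∃ η ∈ paramClass D d, ∀ θ : Vec D,
      ∀ᶠ s in 𝓝[≠] (0 : ℝ), UniqueOptimum Z (paramClass D d) (θ + s • η) := by
  classical
  -- The differences of targets that some parameter of the class tells apart. A tie between two such
  -- targets is a zero of an affine function of `s`.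
  set S : Finset (Vec D) := ((Z ×ˢ Z).image fun p => p.1 - p.2).filter
    fun v => ∃ η ∈ paramClass D d, (inner ℝ η v : ℝ) ≠ 0 with hS
  obtain ⟨η, hη, hne⟩ := exists_forall_inner_ne_zero (d := d) S fun v hv => (Finset.mem_filter.1 hv).2
  refine ⟨η, hη, fun θ => ?_⟩
  have hev : ∀ᶠ s in 𝓝[≠] (0 : ℝ), ∀ v ∈ S, (inner ℝ (θ + s • η) v : ℝ) ≠ 0 := by
    rw [eventually_all_finset]
    intro v hv
    simp only [inner_add_left, real_inner_smul_left]
    exact eventually_add_mul_ne_zero _ _ (Or.inr (hne v hv))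
  filter_upwards [hev] with s hs z hz z' hz' η' hη'
  by_contra hcon
  refine hs (z - z') (Finset.mem_filter.2 ⟨Finset.mem_image.2 ⟨(z, z'),
    Finset.mem_product.2 ⟨hz.1, hz'.1⟩, rfl⟩, η', hη', ?_⟩) ?_
  · rw [inner_sub_right]
    exact sub_ne_zero.2 hcon
  · rw [inner_sub_right]
    exact sub_eq_zero.2 (le_antisymm (hz'.2 z hz.1) (hz.2 z' hz'.1))

theorem uniqueOptimum_of_lt {D : ℕ} {Z : Finset (Vec D)} {Θ : Set (Vec D)} {θ zs : Vec D}
    (hzs : zs ∈ Z) (hopt : ∀ z ∈ Z, z ≠ zs → (inner ℝ θ z : ℝ) < inner ℝ θ zs) :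
    UniqueOptimum Z Θ θ ∧ optimalArms Z θ ⊆ {zs} := by
  have h : optimalArms Z θ ⊆ {zs} := by
    intro z hz
    by_contra hne
    exact (hopt z hz.1 hne).not_ge (hz.2 zs hzs)
  refine ⟨fun z hz z' hz' η _ => ?_, h⟩
  rw [h hz, h hz']

/-! ### Lower bounds on the expected numbers of plays -/

namespace Algorithm

variable {D : ℕ} {X Z : Finset (Vec D)}

/-- The optimum for `θ'` need not be unique, so the PAC property is used at the perturbations `θ' +
s • η`. There the optimum is unique and `z` still beats `zs`; the bound is continuous in `s` and
survives `s → 0`. -/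
theorem le_sum_expectedPlays {d : ℕ} (alg : Algorithm X Z) {δ : ℝ} (hδ0 : 0 < δ)
    (hδ : δ ≤ 1 / 2) {θ zs : Vec D} (hθ : θ ∈ paramClass D d) (hzs : zs ∈ Z)
    (hopt : ∀ z ∈ Z, z ≠ zs → (inner ℝ θ z : ℝ) < inner ℝ θ zs)
    (hPAC : IsPAC alg δ (paramClass D d)) (hτ : alg.expectedStoppingTime θ ≠ ∞)
    {θ' z : Vec D} (hθ' : θ' ∈ paramClass D d) (hz : z ∈ Z)
    (hlt : (inner ℝ θ' zs : ℝ) < inner ℝ θ' z) :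
    (1 - 2 * δ) * Real.log ((1 - δ) / δ) ≤
      ∑ x : X, alg.expectedPlays θ x * (inner ℝ (θ - θ') (x : Vec D) ^ 2 / 2) := by
  obtain ⟨η, hη, hgen⟩ := exists_eventually_uniqueOptimum d Z
  have hS : MeasurableSet[alg.isStoppingTime.measurableSpace] {ω | (alg.recommend ω : Vec D) = zs} := by
    have := alg.measurable_recommend (measurableSet_singleton (⟨zs, hzs⟩ : Z))
    convert this using 1
    ext ω
    simp [Subtype.ext_iff]
  obtain ⟨hu, hsub⟩ := uniqueOptimum_of_lt (Θ := paramClass D d) hzs hopt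
  have h1 : 1 - δ ≤ (alg.law θ).real {ω | alg.τ ω ≠ ⊤ ∧ ω ∈ {ω | (alg.recommend ω : Vec D) = zs}} :=
    (hPAC θ hθ hu).trans (measureReal_mono fun ω hω => ⟨hω.1, hsub hω.2⟩)
  have hlt' : ∀ᶠ s in 𝓝[≠] (0 : ℝ),
      (inner ℝ (θ' + s • η) zs : ℝ) < inner ℝ (θ' + s • η) z := by
    refine Filter.Eventually.filter_mono nhdsWithin_le_nhds ?_
    have hc (w : Vec D) : Tendsto (fun s : ℝ => (inner ℝ (θ' + s • η) w : ℝ)) (𝓝 0)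
        (𝓝 (inner ℝ θ' w)) := by
      have : Continuous fun s : ℝ => (inner ℝ (θ' + s • η) w : ℝ) := by fun_prop
      simpa using this.tendsto 0
    exact (hc zs).eventually_lt (hc z) hlt
  have hbound : ∀ᶠ s in 𝓝[≠] (0 : ℝ), (1 - 2 * δ) * Real.log ((1 - δ) / δ) ≤
      ∑ x : X, alg.expectedPlays θ x * (inner ℝ (θ - (θ' + s • η)) (x : Vec D) ^ 2 / 2) := by
    filter_upwards [hlt', hgen θ'] with s hs hus
    refine alg.transportation θ _ hτ hS hδ0 hδ h1 ?_
    have hp := hPAC _ (add_smul_mem_paramClass hθ' hη s) hus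
    have hSm := alg.isStoppingTime.measurableSpace_le _ hS
    have htop : MeasurableSet {ω | alg.τ ω ≠ ⊤} :=
      (alg.measurable_τ (measurableSet_singleton ⊤)).compl
    -- Since `zs` is not optimal at the perturbed parameter, recommending it is an error, of
    -- probability at most `δ`.
    have hdisj : Disjoint {ω | alg.τ ω ≠ ⊤ ∧ (alg.recommend ω : Vec D) ∈ optimalArms Z (θ' + s • η)}
        {ω | alg.τ ω ≠ ⊤ ∧ ω ∈ {ω | (alg.recommend ω : Vec D) = zs}} := by
      refine Set.disjoint_left.2 fun ω h h' => ?_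
      have h3 := h.2
      rw [show (alg.recommend ω : Vec D) = zs from h'.2] at h3
      exact (h3.2 z hz).not_gt hs
    have := measureReal_union (μ := alg.law (θ' + s • η)) hdisj (htop.inter hSm)
    have h1' := measureReal_le_one (μ := alg.law (θ' + s • η))
      (s := {ω | alg.τ ω ≠ ⊤ ∧ (alg.recommend ω : Vec D) ∈ optimalArms Z (θ' + s • η)} ∪
        {ω | alg.τ ω ≠ ⊤ ∧ ω ∈ {ω | (alg.recommend ω : Vec D) = zs}})
    linarith
  have hcont : Continuous fun s : ℝ =>
      ∑ x : X, alg.expectedPlays θ x * (inner ℝ (θ - (θ' + s • η)) (x : Vec D) ^ 2 / 2) := by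
    fun_prop
  have hlim := (hcont.tendsto 0).mono_left (nhdsWithin_le_nhds (s := {0}ᶜ))
  simp only [zero_smul, add_zero] at hlim
  exact ge_of_tendsto hlim hbound

/-- The lower bound for the numbers of plays in the direction of `Δ`, if moving against `Δ` closes
the gap between `zs` and `z`. -/
theorem log_le_sum_expectedPlays {d : ℕ} (alg : Algorithm X Z) {δ : ℝ} (hδ0 : 0 < δ)
    (hδ : δ ≤ 0.15) {θ zs : Vec D} (hθ : θ ∈ paramClass D d) (hzs : zs ∈ Z)
    (hopt : ∀ z ∈ Z, z ≠ zs → (inner ℝ θ z : ℝ) < inner ℝ θ zs)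
    (hPAC : IsPAC alg δ (paramClass D d)) (hτ : alg.expectedStoppingTime θ ≠ ∞)
    {Δ z : Vec D} (hΔ : Δ ∈ paramClass D d) (hz : z ∈ Z) (hne : z ≠ zs)
    (hgap : (inner ℝ Δ zs : ℝ) - inner ℝ Δ z = inner ℝ θ zs - inner ℝ θ z) :
    Real.log (1 / (2.4 * δ)) ≤ ∑ x : X, alg.expectedPlays θ x * inner ℝ Δ (x : Vec D) ^ 2 := by
  have hg := hopt z hz hne
  -- Overshooting by the factor `1.1` makes `z` strictly better than `zs`. The cost is `1.1² / 2 =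
  -- 0.605`, which stays below `0.7 ≤ 1 - 2δ`, so no limit is needed.
  have h := alg.le_sum_expectedPlays hδ0 (by linarith) hθ hzs hopt hPAC hτ
    (add_smul_mem_paramClass hθ hΔ (-1.1)) hz (by
      simp only [inner_add_left, real_inner_smul_left]
      linarith)
  have he : ∑ x : X, alg.expectedPlays θ x *
      (inner ℝ (θ - (θ + (-1.1 : ℝ) • Δ)) (x : Vec D) ^ 2 / 2) =
      0.605 * ∑ x : X, alg.expectedPlays θ x * inner ℝ Δ (x : Vec D) ^ 2 := by
    rw [Finset.mul_sum]
    refine Finset.sum_congr rfl fun x _ => ?_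
    simp only [inner_sub_left, inner_add_left, real_inner_smul_left]
    ring
  rw [he] at h
  have h0 : 0 ≤ ∑ x : X, alg.expectedPlays θ x * inner ℝ Δ (x : Vec D) ^ 2 :=
    Finset.sum_nonneg fun x _ => mul_nonneg (alg.expectedPlays_nonneg θ x) (sq_nonneg _)
  have hl1 : Real.log (1 / (2.4 * δ)) ≤ Real.log ((1 - δ) / δ) := by
    refine Real.log_le_log (by positivity) ?_
    rw [div_le_div_iff₀ (by positivity) hδ0]
    nlinarith
  have hl0 : 0 ≤ Real.log ((1 - δ) / δ) :=
    Real.log_nonneg ((one_le_div hδ0).2 (by linarith))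
  have hl2 : 0.7 * Real.log ((1 - δ) / δ) ≤ (1 - 2 * δ) * Real.log ((1 - δ) / δ) :=
    mul_le_mul_of_nonneg_right (by linarith) hl0
  linarith

end Algorithm

/-! ### From numbers of plays to the complexity -/

/-- The vector of `Θ_d` with the given first `d` coordinates. -/
noncomputable def extendZero {d : ℕ} (D : ℕ) (v : Fin d → ℝ) : Vec D :=
  WithLp.toLp 2 fun i => if h : (i : ℕ) < d then v ⟨i, h⟩ else 0

theorem extendZero_mem {d : ℕ} (D : ℕ) (v : Fin d → ℝ) : extendZero D v ∈ paramClass D d := by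
  intro i hi
  simp [extendZero, not_lt.2 hi]

theorem inner_extendZero {D d : ℕ} (hd : d ≤ D) (v : Fin d → ℝ) (x : Vec D) :
    (inner ℝ (extendZero D v) x : ℝ) = v ⬝ᵥ truncate hd x := by
  obtain ⟨k, rfl⟩ := Nat.exists_eq_add_of_le hd
  rw [PiLp.inner_apply, Fin.sum_univ_add]
  simp [extendZero, dotProduct, truncate, mul_comm, Fin.castLE, Fin.castAdd]

theorem dotProduct_designMatrix_mulVec {D d : ℕ} (hd : d ≤ D) (X : Finset (Vec D)) (l : X → ℝ)
    (v : Fin d → ℝ) :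
    v ⬝ᵥ (designMatrix hd X l *ᵥ v) = ∑ x : X, l x * (v ⬝ᵥ truncate hd (x : Vec D)) ^ 2 := by
  simp only [designMatrix, Matrix.sum_mulVec, dotProduct_sum, Matrix.smul_mulVec,
    Matrix.vecMulVec_mulVec, dotProduct_smul, smul_eq_mul]
  refine Finset.sum_congr rfl fun x _ => ?_
  simp only [op_smul_eq_mul,
    dotProduct_comm (truncate hd (x : Vec D)) v]
  ring

/-- A vector outside the range of a matrix `A` is detected by an isotropic vector of `A`. -/
theorem exists_dotProduct_ne_zero {d : ℕ} {A : Matrix (Fin d) (Fin d) ℝ} {y : Fin d → ℝ}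
    (h : ¬ ∃ v : Fin d → ℝ, A *ᵥ v = y) :
    ∃ w : Fin d → ℝ, w ⬝ᵥ y ≠ 0 ∧ w ⬝ᵥ (A *ᵥ w) = 0 := by
  have hy : y ∉ LinearMap.range A.mulVecLin := fun ⟨v, hv⟩ => h ⟨v, hv⟩
  -- A functional `w` vanishing on the range of `A` but not at `y`; it kills `A w` in particular.
  obtain ⟨f, hf, hker⟩ := Submodule.exists_le_ker_of_notMem hy
  obtain ⟨w, rfl⟩ := (dotProductEquiv ℝ (Fin d)).surjective f
  exact ⟨w, hf, hker ⟨w, rfl⟩⟩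

/-- The information-theoretic lower bound for the expected stopping time. -/
theorem complexity_mul_log_le_expectedStoppingTime {D d : ℕ} (hd : d ≤ D) (X Z : Finset (Vec D))
    (δ : ℝ) (hδ0 : 0 < δ) (hδ : δ ≤ 0.15)
    (θ : Vec D) (hθ : θ ∈ paramClass D d)
    (zs : Vec D) (hzs : zs ∈ Z)
    (hopt : ∀ z ∈ Z, z ≠ zs → (inner ℝ θ z : ℝ) < inner ℝ θ zs)
    (alg : Algorithm X Z)
    (hPAC : IsPAC alg δ (paramClass D d)) :
    complexity hd X Z θ zs * ENNReal.ofReal (Real.log (1 / (2.4 * δ))) ≤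
      alg.expectedStoppingTime θ := by
  classical
  rcases eq_or_ne (alg.expectedStoppingTime θ) ∞ with hτ | hτ
  · rw [hτ]
    exact le_top
  have hlog : 0 < Real.log (1 / (2.4 * δ)) := by
    refine Real.log_pos ?_
    rw [lt_div_iff₀ (by positivity)]
    linarith
  have hbound {Δ z : Vec D} (hΔ : Δ ∈ paramClass D d) (hz : z ∈ Z) (hne : z ≠ zs)
      (hgap : (inner ℝ Δ zs : ℝ) - inner ℝ Δ z = inner ℝ θ zs - inner ℝ θ z) :=
    alg.log_le_sum_expectedPlays hδ0 hδ hθ hzs hopt hPAC hτ hΔ hz hne hgap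
  have hsum := alg.sum_expectedPlays hτ
  set E := (alg.expectedStoppingTime θ).toReal with hE
  have hE' : 0 ≤ E := ENNReal.toReal_nonneg
  rcases hE'.eq_or_lt with hE0 | hEpos
  -- If `E_θ[τ] = 0`, no competitor to `zs` can exist, as it would force a play. The supremum is
  -- then empty, and the first arm played supplies the design that the infimum needs.
  · have hN (x : X) : alg.expectedPlays θ x = 0 := by
      rw [← hE0] at hsum
      exact (Finset.sum_eq_zero_iff_of_nonneg fun x _ => alg.expectedPlays_nonneg θ x).1 hsum x
        (Finset.mem_univ x)
    have hZ (z : Vec D) (hz : z ∈ Z) : z = zs := by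
      by_contra hne
      have := hbound hθ hz hne rfl
      simp only [hN, zero_mul, Finset.sum_const_zero] at this
      linarith
    have hc : complexity hd X Z θ zs = 0 := by
      refine le_antisymm ((iInf₂_le (Pi.single (alg.arm 0 Fin.elim0) 1)
        (single_mem_stdSimplex ℝ _)).trans ?_) zero_le
      exact iSup₂_le fun z hz => absurd (hZ z hz.1) hz.2
    rw [hc, zero_mul]
    exact zero_le
  rw [← ENNReal.ofReal_toReal hτ, ← hE]
  rw [← ENNReal.le_div_iff_mul_le (Or.inl (by simpa using hlog)) (Or.inl ENNReal.ofReal_ne_top),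
    ← ENNReal.ofReal_div_of_pos hlog]
  set l : X → ℝ := fun x => alg.expectedPlays θ x / E with hl
  have hlmem : l ∈ stdSimplex ℝ X :=
    ⟨fun x => div_nonneg (alg.expectedPlays_nonneg θ x) hEpos.le, by
      simp only [hl]
      rw [← Finset.sum_div, hsum, div_self hEpos.ne']⟩
  have hquad (v : Fin d → ℝ) : ∑ x : X, alg.expectedPlays θ x *
      inner ℝ (extendZero D v) (x : Vec D) ^ 2 = E * (v ⬝ᵥ (designMatrix hd X l *ᵥ v)) := by
    rw [dotProduct_designMatrix_mulVec, Finset.mul_sum]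
    refine Finset.sum_congr rfl fun x _ => ?_
    simp only [inner_extendZero hd, hl]
    field_simp
  refine (iInf₂_le l hlmem).trans (iSup₂_le fun z hz => ?_)
  set g : ℝ := inner ℝ θ zs - inner ℝ θ z with hg
  have hgpos : 0 < g := sub_pos.2 (hopt z hz.1 hz.2)
  have key (v : Fin d → ℝ) (hv : v ⬝ᵥ (truncate hd zs - truncate hd z) = g) :
      Real.log (1 / (2.4 * δ)) ≤ E * (v ⬝ᵥ (designMatrix hd X l *ᵥ v)) := by
    rw [← hquad]
    refine hbound (extendZero_mem D v) hz.1 hz.2 ?_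
    rw [inner_extendZero hd, inner_extendZero hd, ← dotProduct_sub, hv]
  by_cases hrange : ∃ v : Fin d → ℝ, designMatrix hd X l *ᵥ v = truncate hd zs - truncate hd z
  · obtain ⟨v, hv⟩ := hrange
    rw [invNormSq_eq (designMatrix_transpose hd X l) hv, dotProduct_comm,
      ← ENNReal.ofReal_div_of_pos (by positivity)]
    refine ENNReal.ofReal_le_ofReal ?_
    set Q := v ⬝ᵥ (truncate hd zs - truncate hd z) with hQ
    rcases le_or_gt Q 0 with hQ0 | hQ0
    · exact (div_nonpos_of_nonpos_of_nonneg hQ0 (by positivity)).trans (by positivity)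
    -- A solution of `A v = y`, rescaled to meet the constraint, minimizes the quadratic form; its
    -- value there is `g² / Q`.
    have := key ((g / Q) • v) (by rw [smul_dotProduct, ← hQ, smul_eq_mul, div_mul_cancel₀ _ hQ0.ne'])
    rw [Matrix.mulVec_smul, hv, smul_dotProduct, dotProduct_smul, ← hQ] at this
    simp only [smul_eq_mul] at this
    rw [div_le_div_iff₀ (by positivity) hlog]
    calc Q * Real.log (1 / (2.4 * δ)) ≤ Q * (E * (g / Q * (g / Q * Q))) := by gcongr
      _ = E * g ^ 2 := by field_simp
  -- Moving along `w` closes the gap without any information gained by the design, so `key` would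
  -- make the positive logarithm nonpositive.
  · obtain ⟨w, hw, hw0⟩ := exists_dotProduct_ne_zero hrange
    have := key ((g / (w ⬝ᵥ (truncate hd zs - truncate hd z))) • w)
      (by rw [smul_dotProduct, smul_eq_mul, div_mul_cancel₀ _ hw])
    rw [Matrix.mulVec_smul, smul_dotProduct, dotProduct_smul, hw0, smul_zero, smul_zero,
      mul_zero] at this
    linarith

end LinearBandit

theorem mainTheorem3 {D d : ℕ} (hd : d ≤ D) (X Z : Finset (LinearBandit.Vec D))
    (δ : ℝ) (hδ0 : 0 < δ) (hδ : δ ≤ 0.15)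
    (θ : LinearBandit.Vec D) (hθ : θ ∈ LinearBandit.paramClass D d)
    (zs : LinearBandit.Vec D) (hzs : zs ∈ Z)
    (hopt : ∀ z ∈ Z, z ≠ zs → (inner ℝ θ z : ℝ) < inner ℝ θ zs)
    (alg : LinearBandit.Algorithm X Z)
    (hPAC : LinearBandit.IsPAC alg δ (LinearBandit.paramClass D d)) :
    LinearBandit.complexity hd X Z θ zs * ENNReal.ofReal (Real.log (1 / (2.4 * δ))) ≤
      alg.expectedStoppingTime θ :=
  LinearBandit.complexity_mul_log_le_expectedStoppingTime hd X Z δ hδ0 hδ θ hθ zs hzs hopt alg hPAC
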